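/- All spaces are real. Let $(X,\|\cdot\|)$ be a normed space. An \emph{analytic norm} on $X$ is a norm $p$ on $X$, equivalent to $\|\cdot\|$, that is real analytic on $X\setminus\{0\}$: for every $a\neq 0$ there are $\delta>0$ and continuous $n$-homogeneous polynomials $P_n\colon X\to\mathbb{R}$ $(n\ge 0)$ with $\sum_n\|P_n\|\delta^n<\infty$ and $p(x)=\sum_{n\ge 0}P_n(x-a)$ whenever $\|x-a\|<\delta$. We say that $X$ admits an analytic norm \emph{approximating} $\|\cdot\|$ if for every $\varepsilon>0$ there is an analytic norm $p$ on $X$ with $p(x)\le\|x\|\le(1+\varepsilon)\,p(x)$ for all $x\in X$. \textbf{Theorem A.} (i) The space $\ell_\infty^F$ of all sequences in $\ell_\infty$ that take only finitely many values is a dense linear subspace of $\ell_\infty$, and it admits an analytic norm approximating $\|\cdot\|_\infty$. (ii) Every normed space with a countable (finite or infinite) Hamel basis admits an analytic norm approximating its norm. Every separable Banach space $X$ has a dense linear subspace $Y$ that admits an analytic norm approximating the norm that $Y$ inherits from $X$. (iii) Let $\mathfrak{c}$ be the cardinality of the continuum. The finitely supported vectors form a dense linear subspace of $\ell_1(\mathfrak{c})$,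 and this subspace admits an analytic norm approximating $\|\cdot\|_1$. -/

import Mathlib

open scoped ENNReal Cardinal

universe u v w t

namespace AnalyticRenorming

/-- An equivalent analytic norm on the real normed space `X`: a seminorm that vanishes only at `0`,
is equivalent to the given norm, and is real analytic at every point of `X \ {0}`.
(Mathlib's `AnalyticOnNhd` asks at each point for a power series of continuous multilinear maps of
positive radius of convergence that sums to the function near that point. It makes sense without
completeness, and it implies the pointwise representability by a series of continuous homogeneous
polynomials on a ball.) -/
structure IsAnalyticNorm {X : Type*} [NormedAddCommGroup X] [NormedSpace ℝ X]
    (p : Seminorm ℝ X) : Prop where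
  eq_zero_of_map_eq_zero : ∀ x, p x = 0 → x = 0
  equivalent : ∃ c C : ℝ, 0 < c ∧ 0 < C ∧ ∀ x, c * ‖x‖ ≤ p x ∧ p x ≤ C * ‖x‖
  analytic : AnalyticOnNhd ℝ (fun x => p x) {x : X | x ≠ 0}

/-- The norm `p` `ε`-approximates the given norm of `X`: `p ≤ ‖·‖ ≤ (1 + ε) p`. -/
def EpsApproximates {X : Type*} [NormedAddCommGroup X] [NormedSpace ℝ X]
    (ε : ℝ) (p : Seminorm ℝ X) : Prop :=
  ∀ x, p x ≤ ‖x‖ ∧ ‖x‖ ≤ (1 + ε) * p x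

/-- The normed space `X` admits an equivalent analytic norm approximating its given norm, with
any prescribed accuracy. -/
def AdmitsApproximatingAnalyticNorm (X : Type*) [NormedAddCommGroup X] [NormedSpace ℝ X] : Prop :=
  ∀ ε : ℝ, 0 < ε → ∃ p : Seminorm ℝ X, IsAnalyticNorm p ∧ EpsApproximates ε p

/-- The subspace of finitely-valued sequences in the real Banach space of bounded sequences, with
the supremum norm. -/
def ellInftyF : Submodule ℝ (lp (fun _ : ℕ => ℝ) ∞) where
  carrier := {x | (Set.range (fun i => x i)).Finite}
  zero_mem' := by
    refine (Set.finite_singleton (0 : ℝ)).subset ?_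
    rintro _ ⟨i, rfl⟩
    simp
  add_mem' := by
    intro x y hx hy
    refine (Set.Finite.image2 (fun a b : ℝ => a + b) hx hy).subset ?_
    rintro _ ⟨i, rfl⟩
    exact ⟨x i, ⟨i, rfl⟩, y i, ⟨i, rfl⟩, rfl⟩
  smul_mem' := by
    intro c x hx
    refine (Set.Finite.image (fun a : ℝ => c * a) hx).subset ?_
    rintro _ ⟨i, rfl⟩
    exact ⟨x i, ⟨i, rfl⟩, rfl⟩

/-- The subspace of finitely supported vectors in the real Banach space of absolutely summable
families indexed by `S`, with the `1`-norm. -/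
def ellOneFin (S : Type*) : Submodule ℝ (lp (fun _ : S => ℝ) 1) where
  carrier := {x | {s : S | x s ≠ 0}.Finite}
  zero_mem' := by simp
  add_mem' := by
    intro x y hx hy
    refine (Set.Finite.union hx hy).subset ?_
    intro s hs
    by_contra h
    simp only [Set.mem_union, Set.mem_ofPred_eq, not_or, not_not] at h
    exact hs (by simp [h.1, h.2])
  smul_mem' := by
    intro c x hx
    refine Set.Finite.subset hx ?_
    intro s hs h
    exact hs (by simp [h])

end AnalyticRenorming

open AnalyticRenorming

/-!
The proof builds one norm on the Banach space `ℕ →ᵇ ℝ` of bounded sequences and pulls it back to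
each of the spaces in question.

For `m ≥ 1` let `Φ(y) = ∑ yₙ ^ (2 (n + m))` and let `N` be the gauge of `{Φ ≤ 1}`. As `m` grows,
this body fills up the unit ball, so that `N` approximates the supremum norm as closely as desired.
Since the exponents are strictly increasing, `Φ` of a shifted sequence is a power series in its
squared entries, with one monomial in each degree and radius of convergence `1`
(`analyticAt_tsum_clm_pow`). Hence `Φ` is analytic at every sequence `y` with `limsup |yₙ| < 1`:
finitely many coordinates contribute a polynomial, and the remaining ones form a sequence in the
open unit ball (`analyticAt_evenPowerSum`). If `limsup |yₙ| < ‖y‖`, then `Φ` is analytic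
near `y / N(y)`, the equation `Φ(t • y) = 1` has the solution `t = 1 / N(y)`, and the derivative
in `t` is positive there, so the implicit function theorem makes `N` analytic at `y`
(`analyticAt_gauge_evenPowerBody`). The implicit function theorem is used only on the complete space
`ℕ →ᵇ ℝ`; the normed spaces of the theorem need not be complete.

Now let `X` be a normed space with functionals `gₙ`, where `‖gₙ‖ ≤ 1 + aₙ` and `aₙ → 0`, such that
every `x ≠ 0` satisfies `‖x‖ < |gₙ x|` for some `n`. Then `limsup |gₙ x| ≤ ‖x‖ < sup |gₙ x|`,
so `N ∘ (gₙ)ₙ` is analytic off `0`, and up to a constant factor it is the required norm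
(`admitsApproximatingAnalyticNorm_of_countable`). Such functionals arise from any countable family
in the dual unit ball that attains the norm of every vector, on multiplying the members by factors
tending to `1` from above: the coordinates for finitely valued sequences, and for finitely supported
vectors in `ℓ₁(𝔠)` a countable set of sign vectors that is dense in `{-1, 1} ^ 𝔠`. For a space with a
countable Hamel basis, compactness of the spheres of an exhausting sequence of finite-dimensional
subspaces gives, for each of them, finitely many functionals that almost attain the norm; the
factor `1 + aₙ` makes up for the loss.
-/

open Filter Topology BoundedContinuousFunction

/-! ### Analyticity of the even power sum -/

/-- Functionals in the dual unit ball yield a power series `∑ cₙ(y) ^ n` about `0` with one term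
in each degree, hence an analytic function on the unit ball. -/
lemma analyticAt_tsum_clm_pow {F : Type*} [NormedAddCommGroup F] [NormedSpace ℝ F]
    (c : ℕ → F →L[ℝ] ℝ) (hc : ∀ n, ‖c n‖ ≤ 1) {x : F} (hx : ‖x‖ < 1) :
    AnalyticAt ℝ (fun y => ∑' n, c n y ^ n) x := by
  let p : FormalMultilinearSeries ℝ F ℝ := fun n =>
    (ContinuousMultilinearMap.mkPiAlgebraFin ℝ n ℝ).compContinuousLinearMap (fun _ => c n)
  have hp : ∀ n, ‖p n‖ ≤ 1 := fun n => by
    refine (ContinuousMultilinearMap.norm_compContinuousLinearMap_le _ _).trans ?_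
    rw [ContinuousMultilinearMap.norm_mkPiAlgebraFin, one_mul]
    exact Finset.prod_le_one (fun _ _ => norm_nonneg _) (fun _ _ => hc n)
  have h : HasFPowerSeriesOnBall (fun y => ∑' n, c n y ^ n) p 0 1 := by
    refine ⟨?_, one_pos, fun {y} hy => ?_⟩
    · simpa using p.le_radius_of_bound (r := 1) 1 (by simpa using hp)
    · have hy1 : ‖y‖ < 1 := by
        rw [← ENNReal.ofReal_one, Metric.eball_ofReal] at hy
        simpa using hy
      have hs : Summable fun n => c n y ^ n := by
        refine Summable.of_norm_bounded (summable_geometric_of_lt_one (norm_nonneg y) hy1)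
          fun n => ?_
        rw [norm_pow]
        refine pow_le_pow_left₀ (norm_nonneg _) ?_ n
        simpa using (c n).le_of_opNorm_le (hc n) y
      simpa [p, List.prod_ofFn] using hs.hasSum
  refine h.analyticAt_of_mem ?_
  rw [← ENNReal.ofReal_one, Metric.eball_ofReal]
  simpa using hx

/-- The shift of bounded sequences by `k` places to the left, which drops the first `k` entries. -/
noncomputable def seqShift (k : ℕ) : (ℕ →ᵇ ℝ) →L[ℝ] (ℕ →ᵇ ℝ) :=
  LinearMap.mkContinuous
    { toFun := fun y => y.compContinuous ⟨fun n => n + k, continuous_of_discreteTopology⟩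
      map_add' := fun _ _ => rfl
      map_smul' := fun _ _ => rfl } 1
    (fun y => by
      rw [one_mul]
      exact (BoundedContinuousFunction.norm_le (norm_nonneg y)).2
        fun n => y.norm_coe_le_norm (n + k))

@[simp] lemma seqShift_apply (k : ℕ) (y : ℕ →ᵇ ℝ) (n : ℕ) : seqShift k y n = y (n + k) := rfl

lemma norm_evalCLM_le_one (n : ℕ) : ‖BoundedContinuousFunction.evalCLM ℝ (β := ℝ) n‖ ≤ 1 :=
  ContinuousLinearMap.opNorm_le_bound _ zero_le_one fun y => by
    simpa using y.norm_coe_le_norm n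

lemma summable_pow_add (M : ℕ) {w : ℕ → ℝ} {q : ℝ} (hq0 : 0 ≤ q) (hq : q < 1)
    (h : ∀ᶠ n in atTop, |w n| ≤ q) : Summable fun n => w n ^ (n + M) := by
  have hg : Summable fun n : ℕ => q ^ n * q ^ M :=
    (summable_geometric_of_lt_one hq0 hq).mul_right _
  refine Summable.of_norm_bounded_eventually_nat hg ?_
  filter_upwards [h] with n hn
  rw [norm_pow, ← pow_add]
  exact pow_le_pow_left₀ (norm_nonneg _) hn _

lemma analyticAt_tsum_eval_pow (M : ℕ) {x : ℕ →ᵇ ℝ} (hx : ‖x‖ < 1) :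
    AnalyticAt ℝ (fun w : ℕ →ᵇ ℝ => ∑' n, w n ^ (n + M)) x := by
  -- For `n < M` truncated subtraction gives the `0`-th coordinate; these terms are subtracted again.
  let c : ℕ → (ℕ →ᵇ ℝ) →L[ℝ] ℝ := fun n => BoundedContinuousFunction.evalCLM ℝ (n - M)
  have h1 := analyticAt_tsum_clm_pow c (fun n => norm_evalCLM_le_one _) hx
  have h2 : AnalyticAt ℝ (fun w : ℕ →ᵇ ℝ => ∑ n ∈ Finset.range M, c n w ^ n) x :=
    Finset.analyticAt_fun_sum _ fun n _ => ((c n).analyticAt x).pow n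
  refine (h1.sub h2).congr ?_
  filter_upwards [Metric.isOpen_ball.mem_nhds (show x ∈ Metric.ball 0 1 by simpa using hx)]
    with w hw
  have hw : ‖w‖ < 1 := by simpa using hw
  have hs : Summable fun n => w n ^ (n + M) :=
    summable_pow_add M (norm_nonneg w) hw (.of_forall fun n => w.norm_coe_le_norm n)
  have hs' : Summable fun n => c n w ^ n := by
    rw [← summable_nat_add_iff M]
    simpa [c] using hs
  have := hs'.sum_add_tsum_nat_add M
  simp only [Pi.sub_apply]
  rw [← this]
  simp [c]

/-- The function `∑ yₙ ^ (2 (n + m))` on bounded sequences. It is meaningful where the series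
converges, in particular on `eventuallySmall`. -/
noncomputable def evenPowerSum (m : ℕ) (y : ℕ →ᵇ ℝ) : ℝ := ∑' n, y n ^ (2 * (n + m))

/-- The set of bounded sequences whose entries are eventually bounded away from `1` in absolute
value. -/
def eventuallySmall : Set (ℕ →ᵇ ℝ) := {y | ∃ q < 1, ∀ᶠ n in atTop, |y n| ≤ q}

lemma exists_nonneg_of_mem_eventuallySmall {y : ℕ →ᵇ ℝ} (hy : y ∈ eventuallySmall) :
    ∃ q, 0 ≤ q ∧ q < 1 ∧ ∀ᶠ n in atTop, |y n| ≤ q := by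
  obtain ⟨q, hq, h⟩ := hy
  obtain ⟨n, hn⟩ := h.exists
  exact ⟨q, (abs_nonneg _).trans hn, hq, h⟩

lemma isOpen_eventuallySmall : IsOpen eventuallySmall := by
  rw [Metric.isOpen_iff]
  rintro y ⟨q, hq, h⟩
  refine ⟨(1 - q) / 2, by linarith, fun z hz => ⟨q + (1 - q) / 2, by linarith, ?_⟩⟩
  filter_upwards [h] with n hn
  have h1 : |z n - y n| ≤ dist z y := by
    simpa [Real.dist_eq] using BoundedContinuousFunction.dist_coe_le_dist (f := z) (g := y) n
  have h2 : dist z y < (1 - q) / 2 := hz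
  have h3 := abs_sub_abs_le_abs_sub (z n) (y n)
  linarith

lemma summable_evenPower (m : ℕ) {y : ℕ →ᵇ ℝ} (hy : y ∈ eventuallySmall) :
    Summable fun n => y n ^ (2 * (n + m)) := by
  obtain ⟨q, hq0, hq, h⟩ := exists_nonneg_of_mem_eventuallySmall hy
  simp_rw [pow_mul]
  refine summable_pow_add m (sq_nonneg q) (by nlinarith) ?_
  filter_upwards [h] with n hn
  rw [abs_pow]
  exact pow_le_pow_left₀ (abs_nonneg _) hn 2

/-- Near a sequence of `eventuallySmall`, the function is a finite sum of powers of coordinates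
plus a power series evaluated at the square of a shift that lies in the open unit ball. -/
lemma analyticAt_evenPowerSum (m : ℕ) {y : ℕ →ᵇ ℝ} (hy : y ∈ eventuallySmall) :
    AnalyticAt ℝ (evenPowerSum m) y := by
  obtain ⟨q, hq0, hq, h⟩ := exists_nonneg_of_mem_eventuallySmall hy
  obtain ⟨J, hJ⟩ := eventually_atTop.1 h
  have h1 : AnalyticAt ℝ (fun z : ℕ →ᵇ ℝ => ∑ n ∈ Finset.range J, z n ^ (2 * (n + m))) y :=
    Finset.analyticAt_fun_sum _ fun n _ =>
      ((BoundedContinuousFunction.evalCLM ℝ n).analyticAt y).pow _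
  have hsh : AnalyticAt ℝ (fun z : ℕ →ᵇ ℝ => seqShift J z * seqShift J z) y :=
    ((seqShift J).analyticAt y).mul ((seqShift J).analyticAt y)
  have hlt : ‖seqShift J y * seqShift J y‖ < 1 := by
    have : ‖seqShift J y‖ ≤ q :=
      (BoundedContinuousFunction.norm_le hq0).2 fun n => hJ (n + J) (by omega)
    refine (norm_mul_le _ _).trans_lt ?_
    nlinarith [norm_nonneg (seqShift J y)]
  have h2 := (analyticAt_tsum_eval_pow (J + m) hlt).comp_of_eq hsh rfl
  refine (h1.add h2).congr ?_
  filter_upwards [isOpen_eventuallySmall.mem_nhds hy] with z hz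
  rw [evenPowerSum, ← (summable_evenPower m hz).sum_add_tsum_nat_add J]
  simp only [Pi.add_apply, Function.comp, BoundedContinuousFunction.mul_apply, seqShift_apply]
  congr 1
  refine tsum_congr fun n => ?_
  rw [← sq, ← pow_mul, add_assoc]

/-! ### The gauge of the even power body -/

lemma evenPower_nonneg (m n : ℕ) (a : ℝ) : 0 ≤ a ^ (2 * (n + m)) :=
  (even_two_mul _).pow_nonneg a

/-- All exponents are at least `2`, which yields a lower bound for the growth of the sum on rays. -/
lemma sq_mul_evenPowerSum_le {m : ℕ} (hm : 1 ≤ m) {y : ℕ →ᵇ ℝ} {s : ℝ} (hs : 1 ≤ s)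
    (hy : y ∈ eventuallySmall) (hsy : s • y ∈ eventuallySmall) :
    s ^ 2 * evenPowerSum m y ≤ evenPowerSum m (s • y) := by
  rw [evenPowerSum, evenPowerSum, ← tsum_mul_left]
  refine Summable.tsum_le_tsum (fun n => ?_) ((summable_evenPower m hy).mul_left _)
    (summable_evenPower m hsy)
  rw [BoundedContinuousFunction.smul_apply, smul_eq_mul, mul_pow]
  exact mul_le_mul_of_nonneg_right (pow_le_pow_right₀ hs (by omega)) (evenPower_nonneg _ _ _)

/-- The bounded sequences with `∑ yₙ ^ (2 (n + m)) ≤ 1`. The condition is put on the finite partial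
sums, so that it also forces convergence of the series. -/
def evenPowerBody (m : ℕ) : Set (ℕ →ᵇ ℝ) :=
  {y | ∀ s : Finset ℕ, ∑ n ∈ s, y n ^ (2 * (n + m)) ≤ 1}

lemma convex_evenPowerBody (m : ℕ) : Convex ℝ (evenPowerBody m) := by
  intro x hx y hy a b ha hb hab s
  have h1 := hx s
  have h2 := hy s
  calc ∑ n ∈ s, (a • x + b • y) n ^ (2 * (n + m))
      ≤ ∑ n ∈ s, (a * x n ^ (2 * (n + m)) + b * y n ^ (2 * (n + m))) :=
        Finset.sum_le_sum fun n _ =>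
          ((even_two_mul (n + m)).convexOn_pow (𝕜 := ℝ)).2 trivial trivial ha hb hab
    _ = a * ∑ n ∈ s, x n ^ (2 * (n + m)) + b * ∑ n ∈ s, y n ^ (2 * (n + m)) := by
        rw [Finset.sum_add_distrib, Finset.mul_sum, Finset.mul_sum]
    _ ≤ 1 := by nlinarith

lemma balanced_evenPowerBody (m : ℕ) : Balanced ℝ (evenPowerBody m) := by
  rintro a ha _ ⟨y, hy, rfl⟩ s
  refine le_trans (Finset.sum_le_sum fun n _ => ?_) (hy s)
  change (a * y n) ^ (2 * (n + m)) ≤ _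
  rw [mul_pow]
  refine mul_le_of_le_one_left (evenPower_nonneg _ _ _) ?_
  rw [← (even_two_mul (n + m)).pow_abs]
  exact pow_le_one₀ (abs_nonneg _) ha

lemma isClosed_evenPowerBody (m : ℕ) : IsClosed (evenPowerBody m) := by
  have : evenPowerBody m =
      ⋂ s : Finset ℕ, {y : ℕ →ᵇ ℝ | ∑ n ∈ s, y n ^ (2 * (n + m)) ≤ 1} := by
    ext y; simp [evenPowerBody]
  rw [this]
  refine isClosed_iInter fun s => isClosed_le (continuous_finsetSum _ fun n _ => ?_)
    continuous_const
  exact ((BoundedContinuousFunction.evalCLM ℝ n).continuous).pow _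

lemma evenPowerBody_subset_closedBall {m : ℕ} (hm : 1 ≤ m) :
    evenPowerBody m ⊆ Metric.closedBall 0 1 := by
  intro y hy
  rw [mem_closedBall_zero_iff, BoundedContinuousFunction.norm_le zero_le_one]
  intro n
  by_contra! h
  have h1 := hy {n}
  rw [Finset.sum_singleton, ← (even_two_mul (n + m)).pow_abs] at h1
  exact absurd h1 (not_le.2 (one_lt_pow₀ h (by omega)))

lemma ball_subset_evenPowerBody {m : ℕ} {r : ℝ} (hr0 : 0 < r) (hr1 : r < 1)
    (hm : (r ^ 2) ^ m ≤ 1 - r ^ 2) : Metric.ball 0 r ⊆ evenPowerBody m := by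
  intro y hy s
  have hy : ‖y‖ < r := by simpa using hy
  have hr2 : r ^ 2 < 1 := by nlinarith
  have hg : Summable fun n : ℕ => (r ^ 2) ^ n * (r ^ 2) ^ m :=
    (summable_geometric_of_lt_one (sq_nonneg r) hr2).mul_right _
  calc ∑ n ∈ s, y n ^ (2 * (n + m)) ≤ ∑ n ∈ s, (r ^ 2) ^ n * (r ^ 2) ^ m := by
        refine Finset.sum_le_sum fun n _ => ?_
        rw [← pow_add, ← pow_mul, ← (even_two_mul (n + m)).pow_abs]
        exact pow_le_pow_left₀ (abs_nonneg _) ((y.norm_coe_le_norm n).trans hy.le) _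
    _ ≤ ∑' n : ℕ, (r ^ 2) ^ n * (r ^ 2) ^ m := hg.sum_le_tsum _ fun n _ => by positivity
    _ ≤ 1 := by
        rw [tsum_mul_right, tsum_geometric_of_lt_one (sq_nonneg r) hr2,
          inv_mul_le_iff₀ (by linarith)]
        linarith

lemma ball_half_subset_evenPowerBody {m : ℕ} (hm : 1 ≤ m) :
    Metric.ball 0 (1 / 2) ⊆ evenPowerBody m := by
  refine ball_subset_evenPowerBody (by norm_num) (by norm_num) ?_
  calc (((1 : ℝ) / 2) ^ 2) ^ m ≤ ((1 / 2) ^ 2) ^ 1 :=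
        pow_le_pow_of_le_one (by norm_num) (by norm_num) hm
    _ ≤ 1 - (1 / 2) ^ 2 := by norm_num

lemma absorbent_evenPowerBody {m : ℕ} (hm : 1 ≤ m) : Absorbent ℝ (evenPowerBody m) :=
  (absorbent_ball_zero (half_pos one_pos)).mono (ball_half_subset_evenPowerBody hm)

lemma exists_smul_eq_of_gauge_lt_one {E : Type*} [SeminormedAddCommGroup E] [NormedSpace ℝ E]
    {s : Set E} {r : ℝ} (hr : 0 < r) (hs : Metric.ball 0 r ⊆ s) {x : E} (h : gauge s x < 1) :
    ∃ t : ℝ, 0 < t ∧ t < 1 ∧ ∃ w ∈ s, t • w = x :=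
  exists_lt_of_gauge_lt ((absorbent_ball_zero hr).mono hs) h

lemma norm_le_gauge_evenPowerBody {m : ℕ} (hm : 1 ≤ m) (y : ℕ →ᵇ ℝ) :
    ‖y‖ ≤ gauge (evenPowerBody m) y := by
  have h := le_gauge_of_subset_closedBall (r := 1) (x := y) (absorbent_evenPowerBody hm)
    zero_le_one (evenPowerBody_subset_closedBall hm)
  rwa [div_one] at h

lemma mem_evenPowerBody_of_sum_le {m : ℕ} {y : ℕ →ᵇ ℝ} (hy : y ∈ eventuallySmall)
    (h : evenPowerSum m y ≤ 1) : y ∈ evenPowerBody m := fun _ =>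
  ((summable_evenPower m hy).sum_le_tsum _ fun _ _ => evenPower_nonneg _ _ _).trans h

lemma gauge_eq_one_of_evenPowerSum_eq_one {m : ℕ} (hm : 1 ≤ m) {y : ℕ →ᵇ ℝ}
    (hy : y ∈ eventuallySmall) (h : evenPowerSum m y = 1) : gauge (evenPowerBody m) y = 1 := by
  refine le_antisymm (gauge_le_one_of_mem (mem_evenPowerBody_of_sum_le hy h.le)) ?_
  by_contra! hlt
  obtain ⟨r, hr0, hr1, w, hw, hwy⟩ :=
    exists_smul_eq_of_gauge_lt_one (half_pos one_pos) (ball_half_subset_evenPowerBody hm) hlt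
  have hcoord : ∀ n, y n = r * w n := fun n => (DFunLike.congr_fun hwy n).symm
  have hle : evenPowerSum m y ≤ r ^ 2 := by
    refine Real.tsum_le_of_sum_le (fun n => evenPower_nonneg _ _ _) fun s => ?_
    calc ∑ n ∈ s, y n ^ (2 * (n + m)) ≤ ∑ n ∈ s, r ^ 2 * w n ^ (2 * (n + m)) := by
          refine Finset.sum_le_sum fun n _ => ?_
          rw [hcoord, mul_pow]
          exact mul_le_mul_of_nonneg_right
            (pow_le_pow_of_le_one hr0.le hr1.le (by omega)) (evenPower_nonneg _ _ _)
      _ ≤ r ^ 2 := by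
          rw [← Finset.mul_sum]
          exact mul_le_of_le_one_right (sq_nonneg r) (hw s)
  rw [h] at hle
  exact absurd hle (not_le.2 (pow_lt_one₀ hr0.le hr1 two_ne_zero))

lemma evenPowerSum_eq_one_of_gauge_eq_one {m : ℕ} (hm : 1 ≤ m) {y : ℕ →ᵇ ℝ}
    (hy : y ∈ eventuallySmall) (h : gauge (evenPowerBody m) y = 1) : evenPowerSum m y = 1 := by
  have hmem : y ∈ evenPowerBody m := by
    have h0 : evenPowerBody m ∈ 𝓝 (0 : ℕ →ᵇ ℝ) :=
      mem_of_superset (Metric.ball_mem_nhds 0 (half_pos one_pos))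
        (ball_half_subset_evenPowerBody hm)
    rw [← (isClosed_evenPowerBody m).closure_eq,
      ← gauge_le_one_iff_mem_closure (convex_evenPowerBody m) h0]
    exact h.le
  refine le_antisymm (Real.tsum_le_of_sum_le (fun n => evenPower_nonneg _ _ _) hmem) ?_
  by_contra! hlt
  -- Otherwise `t • y` still lies in the body for some `t > 1`, and its gauge is `t`.
  have hcont : ContinuousAt (fun t : ℝ => t • y) 1 := by fun_prop
  have h1 : ∀ᶠ t : ℝ in 𝓝 1, t • y ∈ eventuallySmall :=
    hcont (isOpen_eventuallySmall.mem_nhds (by simpa using hy))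
  have h2 : ∀ᶠ t : ℝ in 𝓝 1, evenPowerSum m (t • y) < 1 := by
    have hc : ContinuousAt (fun t : ℝ => evenPowerSum m (t • y)) 1 :=
      ContinuousAt.comp (g := evenPowerSum m)
        (by simpa using (analyticAt_evenPowerSum m hy).continuousAt) hcont
    exact hc.eventually_lt continuousAt_const (by simpa using hlt)
  obtain ⟨t, ⟨h1, h2⟩, ht⟩ := (((h1.and h2).filter_mono nhdsWithin_le_nhds).and
    (self_mem_nhdsWithin (s := Set.Ioi (1 : ℝ)))).exists
  have ht : 1 < t := ht
  have h3 := gauge_le_one_of_mem (mem_evenPowerBody_of_sum_le h1 h2.le)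
  rw [gauge_smul_of_nonneg (zero_le_one.trans ht.le), h, smul_eq_mul] at h3
  linarith

open scoped ContDiff in
/-- The gauge `N` solves `∑ (yₙ / N(y)) ^ (2 (n + m)) = 1`, and the implicit function theorem
applies to this equation at every sequence whose `limsup` of absolute values is smaller than its
norm. -/
theorem analyticAt_gauge_evenPowerBody {m : ℕ} (hm : 1 ≤ m) {y : ℕ →ᵇ ℝ}
    (hy : ∃ q < ‖y‖, ∀ᶠ n in atTop, |y n| ≤ q) : AnalyticAt ℝ (gauge (evenPowerBody m)) y := by
  obtain ⟨q, hq, hyq⟩ := hy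
  have hq0 : 0 ≤ q := by
    obtain ⟨n, hn⟩ := hyq.exists
    exact (abs_nonneg _).trans hn
  have hN : q < gauge (evenPowerBody m) y := hq.trans_le (norm_le_gauge_evenPowerBody hm y)
  have hNpos : 0 < gauge (evenPowerBody m) y := hq0.trans_lt hN
  obtain ⟨t₀, ht₀⟩ : ∃ t₀, t₀ = (gauge (evenPowerBody m) y)⁻¹ := ⟨_, rfl⟩
  have ht₀pos : 0 < t₀ := ht₀ ▸ inv_pos.2 hNpos
  have hsmall : t₀ • y ∈ eventuallySmall := by
    refine ⟨t₀ * q, ?_, ?_⟩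
    · rw [ht₀, inv_mul_lt_iff₀ hNpos]; linarith
    · filter_upwards [hyq] with n hn
      rw [BoundedContinuousFunction.smul_apply, smul_eq_mul, abs_mul, abs_of_pos ht₀pos]
      exact mul_le_mul_of_nonneg_left hn ht₀pos.le
  have hone : evenPowerSum m (t₀ • y) = 1 := by
    refine evenPowerSum_eq_one_of_gauge_eq_one hm hsmall ?_
    rw [gauge_smul_of_nonneg ht₀pos.le, ht₀, smul_eq_mul, inv_mul_cancel₀ hNpos.ne']
  let f : (ℕ →ᵇ ℝ) × ℝ → ℝ := fun v => evenPowerSum m (v.2 • v.1)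
  have hf : AnalyticAt ℝ f (y, t₀) :=
    (analyticAt_evenPowerSum m hsmall).comp_of_eq
      (f := fun v : (ℕ →ᵇ ℝ) × ℝ => v.2 • v.1) (analyticAt_snd.smul analyticAt_fst) rfl
  have hcd : ContDiffAt ℝ ω f (y, t₀) := hf.contDiffAt
  obtain ⟨D, hD⟩ : ∃ D, D = fderiv ℝ f (y, t₀) ∘L .inr ℝ (ℕ →ᵇ ℝ) ℝ := ⟨_, rfl⟩
  have hder : HasDerivAt (fun t => evenPowerSum m (t • y)) (D 1) t₀ := by
    have h1 : HasFDerivAt f (fderiv ℝ f (y, t₀)) (y, t₀) :=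
      hf.differentiableAt.hasFDerivAt
    have h2 : HasDerivAt (fun t : ℝ => (y, t)) ((0 : ℕ →ᵇ ℝ), (1 : ℝ)) t₀ :=
      (hasDerivAt_const t₀ y).prodMk (hasDerivAt_id t₀)
    have := h1.comp_hasDerivAt t₀ h2
    rw [hD]
    exact this
  have hDpos : 0 < D 1 := by
    refine (inv_pos.2 ht₀pos).trans_le ?_
    -- For `t > t₀` the sum at `t • y` is at least `(t / t₀) ^ 2`.
    refine ge_of_tendsto (hder.tendsto_slope.mono_left
      (nhdsWithin_mono t₀ (fun t (ht : t ∈ Set.Ioi t₀) => ne_of_gt ht))) ?_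
    have hc : ContinuousAt (fun t : ℝ => t • y) t₀ := by fun_prop
    have hev : ∀ᶠ t : ℝ in 𝓝 t₀, t • y ∈ eventuallySmall :=
      hc (isOpen_eventuallySmall.mem_nhds hsmall)
    filter_upwards [hev.filter_mono nhdsWithin_le_nhds, self_mem_nhdsWithin] with t h1 ht
    have ht : t₀ < t := ht
    have hs : 1 ≤ t / t₀ := (one_le_div ht₀pos).2 ht.le
    have hts : (t / t₀) • t₀ • y = t • y := by
      rw [smul_smul, div_mul_cancel₀ _ ht₀pos.ne']
    have h2 := sq_mul_evenPowerSum_le hm hs hsmall (hts ▸ h1)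
    rw [hts, hone, mul_one] at h2
    rw [slope_def_field, hone, le_div_iff₀ (sub_pos.2 ht)]
    have h3 : t₀⁻¹ * (t - t₀) = t / t₀ - 1 := by field_simp
    nlinarith
  have hinv : (fderiv ℝ f (y, t₀) ∘L .inr ℝ (ℕ →ᵇ ℝ) ℝ).IsInvertible := by
    rw [← hD]
    refine ⟨ContinuousLinearEquiv.unitsEquivAut ℝ (Units.mk0 (D 1) hDpos.ne'), ?_⟩
    ext
    simp
  have hω : (ω : ℕ∞ω) ≠ 0 := by simp
  let ψ := hcd.implicitFunction hω hinv
  have hψ : AnalyticAt ℝ ψ y :=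
    (hcd.contDiffAt_implicitFunction hω hinv).analyticAt
  have hψy : ψ y = t₀ := hcd.implicitFunction_apply_self hω hinv
  have hψeq : ∀ᶠ x in 𝓝 y, f (x, ψ x) = f (y, t₀) :=
    hcd.eventually_apply_implicitFunction hω hinv
  have hψpos : ∀ᶠ x in 𝓝 y, 0 < ψ x :=
    continuousAt_const.eventually_lt hψ.continuousAt (by rwa [hψy])
  have hψsmall : ∀ᶠ x in 𝓝 y, ψ x • x ∈ eventuallySmall :=
    (hψ.continuousAt.smul continuousAt_id) (isOpen_eventuallySmall.mem_nhds (by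
      simpa [hψy] using hsmall))
  refine (hψ.inv (by rw [hψy]; exact ht₀pos.ne')).congr ?_
  filter_upwards [hψeq, hψpos, hψsmall] with x h1 h2 h3
  have h4 := gauge_eq_one_of_evenPowerSum_eq_one hm h3 (h1.trans hone)
  rw [gauge_smul_of_nonneg h2.le, smul_eq_mul] at h4
  exact (eq_inv_of_mul_eq_one_right h4).symm

/-- A seminorm on bounded sequences that approximates the supremum norm and is analytic wherever
the `limsup` of the absolute values is smaller than the norm. -/
theorem exists_seminorm_analyticAt {δ : ℝ} (hδ : 0 < δ) :
    ∃ N : Seminorm ℝ (ℕ →ᵇ ℝ), (∀ y, ‖y‖ ≤ N y ∧ N y ≤ (1 + δ) * ‖y‖) ∧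
      ∀ y : ℕ →ᵇ ℝ, (∃ q < ‖y‖, ∀ᶠ n in atTop, |y n| ≤ q) → AnalyticAt ℝ (fun z => N z) y := by
  obtain ⟨r, hr⟩ : ∃ r, r = (1 + δ)⁻¹ := ⟨_, rfl⟩
  have hr0 : 0 < r := hr ▸ by positivity
  have hr1 : r < 1 := hr ▸ inv_lt_one_of_one_lt₀ (by linarith)
  have hr2 : r ^ 2 < 1 := by nlinarith
  -- The body contains the ball of radius `r` once the geometric series `∑ r ^ (2 (n + m))` is at
  -- most `1`.
  obtain ⟨m, hm⟩ := exists_pow_lt_of_lt_one (sub_pos.2 hr2) hr2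
  have hm1 : 1 ≤ m := by
    rcases Nat.eq_zero_or_pos m with rfl | h
    · rw [pow_zero] at hm; nlinarith
    · exact h
  refine ⟨gaugeSeminorm (balanced_evenPowerBody m) (convex_evenPowerBody m)
    (absorbent_evenPowerBody hm1), fun y => ⟨norm_le_gauge_evenPowerBody hm1 y, ?_⟩,
    fun y hy => analyticAt_gauge_evenPowerBody hm1 hy⟩
  have := mul_gauge_le_norm (x := y) (ball_subset_evenPowerBody hr0 hr1 hm.le)
  rw [hr, inv_mul_le_iff₀ (by positivity)] at this
  exact this

/-! ### Pulling back along functionals -/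

/-- Pulling back the seminorm on bounded sequences along `T`: the coordinates of `T x` are bounded
by `(1 + δ) ‖x‖`, one of them exceeds `‖x‖`, and in the limit they do not exceed `‖x‖`. -/
theorem admitsApproximatingAnalyticNorm_of_clm {X : Type*} [NormedAddCommGroup X]
    [NormedSpace ℝ X]
    (h : ∀ δ : ℝ, 0 < δ → ∃ T : X →L[ℝ] (ℕ →ᵇ ℝ), (∀ x, ‖T x‖ ≤ (1 + δ) * ‖x‖) ∧
      (∀ x ≠ 0, ∃ n, ‖x‖ < |T x n|) ∧
      ∀ x, ∀ q > ‖x‖, ∀ᶠ n in atTop, |T x n| ≤ q) :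
    AdmitsApproximatingAnalyticNorm X := by
  intro ε hε
  obtain ⟨δ, hδ, hδε⟩ : ∃ δ : ℝ, 0 < δ ∧ (1 + δ) * (1 + δ) ≤ 1 + ε := by
    refine ⟨min 1 (ε / 3), by positivity, ?_⟩
    have h1 := min_le_left 1 (ε / 3)
    have h2 := min_le_right 1 (ε / 3)
    have h3 : 0 < min 1 (ε / 3) := by positivity
    nlinarith
  obtain ⟨T, hT1, hT2, hT3⟩ := h δ hδ
  obtain ⟨N, hN, hNa⟩ := exists_seminorm_analyticAt hδ
  have hpos : 0 < 1 + ε := by linarith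
  have hε' : 0 < (1 + ε)⁻¹ := inv_pos.2 hpos
  have hlow : ∀ x, ‖x‖ ≤ N (T x) := fun x => by
    rcases eq_or_ne x 0 with rfl | hx
    · simp
    · obtain ⟨n, hn⟩ := hT2 x hx
      exact hn.le.trans (((T x).norm_coe_le_norm n).trans (hN (T x)).1)
  have hup : ∀ x, N (T x) ≤ (1 + ε) * ‖x‖ := fun x => by
    have h1 := (hN (T x)).2
    have h2 := mul_le_mul_of_nonneg_left (hT1 x) (show 0 ≤ 1 + δ by linarith)
    have h3 := mul_le_mul_of_nonneg_right hδε (norm_nonneg x)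
    linarith
  let p : Seminorm ℝ X := Real.toNNReal (1 + ε)⁻¹ • N.comp (T : X →ₗ[ℝ] (ℕ →ᵇ ℝ))
  have hp : ∀ x, p x = (1 + ε)⁻¹ * N (T x) := fun x => by
    simp [p, NNReal.smul_def, hpos.le]
  have hple : ∀ x, p x ≤ ‖x‖ := fun x => by
    rw [hp, inv_mul_le_iff₀ hpos]
    exact hup x
  have hlep : ∀ x, ‖x‖ ≤ (1 + ε) * p x := fun x => by
    rw [hp, mul_inv_cancel_left₀ hpos.ne']
    exact hlow x
  refine ⟨p, ⟨fun x hx => ?_, ⟨(1 + ε)⁻¹, 1, hε', one_pos, fun x => ⟨?_, ?_⟩⟩, ?_⟩,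
    fun x => ⟨hple x, hlep x⟩⟩
  · have := hlep x
    rw [hx, mul_zero] at this
    exact norm_le_zero_iff.1 this
  · rw [inv_mul_le_iff₀ hpos]
    exact hlep x
  · rw [one_mul]
    exact hple x
  · intro x hx
    have hA : AnalyticAt ℝ (fun z => N z) (T x) := by
      obtain ⟨n, hn⟩ := hT2 x hx
      have hlt : ‖x‖ < ‖T x‖ := hn.trans_le ((T x).norm_coe_le_norm n)
      obtain ⟨q, hq1, hq2⟩ := exists_between hlt
      exact hNa _ ⟨q, hq2, hT3 x q hq1⟩
    have hB : AnalyticAt ℝ (fun z => N (T z)) x := hA.comp_of_eq (T.analyticAt x) rfl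
    exact analyticAt_const.mul hB

/-- A countable family of functionals, each bounded by `1 + a i` with `a i → 0`, such that at
every nonzero vector some member of the family exceeds the norm. -/
theorem admitsApproximatingAnalyticNorm_of_countable {X : Type*} [NormedAddCommGroup X]
    [NormedSpace ℝ X]
    (h : ∀ δ : ℝ, 0 < δ → ∃ (Λ : Type*) (_ : Countable Λ) (a : Λ → ℝ) (g : Λ → X →ₗ[ℝ] ℝ),
      (∀ i, a i ≤ δ) ∧ Tendsto a cofinite (𝓝 0) ∧
      (∀ i x, |g i x| ≤ (1 + a i) * ‖x‖) ∧ ∀ x ≠ 0, ∃ i, ‖x‖ < |g i x|) :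
    AdmitsApproximatingAnalyticNorm X := by
  refine admitsApproximatingAnalyticNorm_of_clm fun δ hδ => ?_
  obtain ⟨Λ, _, a, g, haδ, ha0, hg, hgx⟩ := h δ hδ
  obtain ⟨e, he⟩ := exists_injective_nat Λ
  -- The family is listed along `e`, with zero functionals in the gaps.
  let G : ℕ → X →ₗ[ℝ] ℝ := Function.extend e g 0
  have hGe : ∀ i, G (e i) = g i := fun i => he.extend_apply _ _ _
  have hG0 : ∀ n, n ∉ Set.range e → G n = 0 := fun n hn =>
    Function.extend_apply' _ _ _ fun ⟨i, hi⟩ => hn ⟨i, hi⟩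
  have hGb : ∀ n x, |G n x| ≤ (1 + δ) * ‖x‖ := fun n x => by
    by_cases hn : n ∈ Set.range e
    · obtain ⟨i, rfl⟩ := hn
      rw [hGe]
      exact (hg i x).trans (mul_le_mul_of_nonneg_right (by linarith [haδ i]) (norm_nonneg x))
    · rw [hG0 n hn]
      simp only [LinearMap.zero_apply, abs_zero]
      positivity
  let T : X →L[ℝ] (ℕ →ᵇ ℝ) := LinearMap.mkContinuous
    { toFun := fun x => BoundedContinuousFunction.ofNormedAddCommGroupDiscrete
        (fun n => G n x) ((1 + δ) * ‖x‖) (fun n => hGb n x)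
      map_add' := fun x y => by ext n; exact map_add (G n) x y
      map_smul' := fun c x => by ext n; exact map_smul (G n) c x } (1 + δ)
    (fun x => BoundedContinuousFunction.norm_ofNormedAddCommGroup_le _ (by positivity) (fun n => hGb n x))
  have hT : ∀ x n, T x n = G n x := fun x n => rfl
  refine ⟨T, fun x => ?_, fun x hx => ?_, fun x q hq => ?_⟩
  · refine (BoundedContinuousFunction.norm_le (by positivity)).2 fun n => hGb n x
  · obtain ⟨i, hi⟩ := hgx x hx
    exact ⟨e i, by rwa [hT, hGe]⟩
  · have hlim : Tendsto (fun i => (1 + a i) * ‖x‖) cofinite (𝓝 ((1 + 0) * ‖x‖)) :=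
      (ha0.const_add 1).mul_const _
    have hev : ∀ᶠ i in cofinite, (1 + a i) * ‖x‖ < q :=
      hlim.eventually_lt_const (by simpa using hq)
    rw [← Nat.cofinite_eq_atTop]
    refine (Filter.eventually_cofinite.1 hev |>.image e).subset fun n hn => ?_
    by_cases hr : n ∈ Set.range e
    · obtain ⟨i, rfl⟩ := hr
      refine ⟨i, fun hi => hn ?_, rfl⟩
      change |T x (e i)| ≤ q
      rw [hT, hGe]
      exact (hg i x).trans hi.le
    · refine absurd ?_ hn
      change |T x n| ≤ q
      rw [hT, hG0 n hr, LinearMap.zero_apply, abs_zero]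
      exact (norm_nonneg x).trans hq.le

lemma tendsto_div_nat_add_one (δ : ℝ) :
    Tendsto (fun n : ℕ => δ / ((n : ℝ) + 1)) atTop (𝓝 0) := by
  simpa [div_eq_mul_inv] using (tendsto_one_div_add_atTop_nhds_zero_nat (𝕜 := ℝ)).const_mul δ

/-- The case of a countable family in the dual unit ball that attains the norm of every vector:
the members are multiplied by factors greater than `1` that tend to `1`. -/
theorem admitsApproximatingAnalyticNorm_of_norm_attaining {X : Type*} [NormedAddCommGroup X]
    [NormedSpace ℝ X] {Λ : Type*} [Countable Λ] (f : Λ → X →ₗ[ℝ] ℝ)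
    (hf : ∀ i x, |f i x| ≤ ‖x‖) (hx : ∀ x, ∃ i, |f i x| = ‖x‖) :
    AdmitsApproximatingAnalyticNorm X := by
  refine admitsApproximatingAnalyticNorm_of_countable fun δ hδ => ?_
  obtain ⟨e, he⟩ := exists_injective_nat Λ
  have hpos : ∀ i, 0 < δ / (e i + 1) := fun i => by positivity
  refine ⟨Λ, inferInstance, fun i => δ / (e i + 1), fun i => (1 + δ / (e i + 1)) • f i,
    fun i => ?_, ?_, fun i x => ?_, fun x hx0 => ?_⟩
  · exact div_le_self hδ.le (by simp)
  · have h1 := he.tendsto_cofinite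
    rw [Nat.cofinite_eq_atTop] at h1
    exact (tendsto_div_nat_add_one δ).comp h1
  · have := hpos i
    rw [LinearMap.smul_apply, smul_eq_mul, abs_mul, abs_of_pos (by positivity)]
    exact mul_le_mul_of_nonneg_left (hf i x) (by positivity)
  · obtain ⟨i, hi⟩ := hx x
    have := hpos i
    refine ⟨i, ?_⟩
    rw [LinearMap.smul_apply, smul_eq_mul, abs_mul, abs_of_pos (by positivity), hi]
    have := norm_pos_iff.2 hx0
    nlinarith [mul_pos (hpos i) this]

/-! ### Finitely valued bounded sequences -/

theorem dense_ellInftyF : Dense (ellInftyF : Set (lp (fun _ : ℕ => ℝ) ∞)) := by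
  intro x
  rw [Metric.mem_closure_iff]
  intro ε hε
  have hε2 := half_pos hε
  -- Round every entry of `x` down to a multiple of `ε / 2`.
  let r : ℕ → ℝ := fun i => (ε / 2) * ⌊x i / (ε / 2)⌋
  have hr : ∀ i, |x i - r i| ≤ ε / 2 := fun i => by
    have h1 := Int.floor_le (x i / (ε / 2))
    have h2 := Int.lt_floor_add_one (x i / (ε / 2))
    rw [le_div_iff₀ hε2] at h1
    rw [div_lt_iff₀ hε2] at h2
    rw [abs_le]
    constructor <;> simp only [r] <;> nlinarith
  have hx : ∀ i, |x i| ≤ ‖x‖ := fun i => lp.norm_apply_le_norm ENNReal.top_ne_zero x i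
  have hmem : Memℓp r ∞ := by
    refine memℓp_infty ⟨‖x‖ + ε / 2, ?_⟩
    rintro _ ⟨i, rfl⟩
    have h1 := hx i
    have h2 := hr i
    rw [abs_le] at h1 h2
    simp only [Real.norm_eq_abs]
    rw [abs_le]
    constructor <;> linarith
  refine ⟨⟨r, hmem⟩, ?_, ?_⟩
  · refine ((Set.finite_Icc ⌊-‖x‖ / (ε / 2)⌋ ⌊‖x‖ / (ε / 2)⌋).image
      (fun k : ℤ => (ε / 2) * k)).subset ?_
    rintro _ ⟨i, rfl⟩
    have h1 := abs_le.1 (hx i)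
    exact ⟨⌊x i / (ε / 2)⌋, ⟨Int.floor_le_floor (by gcongr; exact h1.1),
      Int.floor_le_floor (by gcongr; exact h1.2)⟩, rfl⟩
  · rw [dist_eq_norm]
    refine lt_of_le_of_lt (lp.norm_le_of_forall_le hε2.le fun i => ?_) (half_lt_self hε)
    exact hr i

theorem admitsApproximatingAnalyticNorm_ellInftyF :
    AdmitsApproximatingAnalyticNorm ellInftyF := by
  refine admitsApproximatingAnalyticNorm_of_norm_attaining (Λ := ℕ)
    (fun n => { toFun := fun x => (x : lp (fun _ : ℕ => ℝ) ∞) n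
                map_add' := fun _ _ => rfl
                map_smul' := fun _ _ => rfl }) (fun n x => ?_) fun x => ?_
  · exact lp.norm_apply_le_norm ENNReal.top_ne_zero (x : lp (fun _ : ℕ => ℝ) ∞) n
  · -- A finitely valued sequence attains the supremum of its absolute values.
    obtain ⟨x, hx⟩ := x
    have hfin : (Set.range fun i => x i).Finite := hx
    obtain ⟨_, ⟨n, rfl⟩, hn⟩ := hfin.exists_maximalFor (fun a : ℝ => |a|) _ (Set.range_nonempty _)
    have hmax : ∀ i, |x i| ≤ |x n| := fun i => by
      rcases le_total |x i| |x n| with h | h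
      · exact h
      · exact hn ⟨i, rfl⟩ h
    refine ⟨n, le_antisymm (lp.norm_apply_le_norm ENNReal.top_ne_zero x n) ?_⟩
    exact lp.norm_le_of_forall_le (abs_nonneg _) hmax

/-! ### Finitely supported vectors in `ℓ₁(S)` -/

theorem dense_ellOneFin (S : Type*) : Dense (ellOneFin S : Set (lp (fun _ : S => ℝ) 1)) := by
  classical
  intro x
  refine mem_closure_of_tendsto (lp.hasSum_single ENNReal.one_ne_top x)
    (Eventually.of_forall fun s => Submodule.sum_mem _ fun i _ => ?_)
  refine (Set.finite_singleton i).subset fun j hj => ?_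
  by_contra h
  exact hj (by simp [Set.mem_singleton_iff] at h; simp [h])

lemma ellOne_hasSum_norm {S : Type*} (x : lp (fun _ : S => ℝ) 1) :
    HasSum (fun s => |x s|) ‖x‖ := by
  simpa using lp.hasSum_norm (p := 1) (by simp) x

/-- Finitely many points of a set embedded in `Set ℕ` are told apart by an initial segment of
`ℕ`. -/
lemma exists_separating_initial_segment {S : Type*} (φ : S → Set ℕ) (hφ : Function.Injective φ)
    {F : Set S} (hF : F.Finite) :
    ∃ k : ℕ, ∀ s ∈ F, ∀ t ∈ F, (∀ n < k, n ∈ φ s ↔ n ∈ φ t) → s = t := by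
  have h : ∀ st : S × S, ∃ n, st.1 ≠ st.2 → ¬ (n ∈ φ st.1 ↔ n ∈ φ st.2) := fun st => by
    by_cases hst : st.1 = st.2
    · exact ⟨0, fun h => absurd hst h⟩
    · have : φ st.1 ≠ φ st.2 := fun h => hst (hφ h)
      rw [Ne, Set.ext_iff, not_forall] at this
      exact this.imp fun n hn _ => hn
  choose n hn using h
  obtain ⟨k, hk⟩ := ((hF.prod hF).image n).bddAbove
  refine ⟨k + 1, fun s hs t ht hst => ?_⟩
  by_contra hne
  exact hn (s, t) hne (hst _ (Nat.lt_succ_of_le (hk ⟨(s, t), ⟨hs, ht⟩, rfl⟩)))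

open Classical in
/-- The functional on `ℓ₁(S)` given by the sign vector that is `1` on `A` and `-1` off `A`. -/
noncomputable def signFunctional {S : Type*} (A : Set S) : lp (fun _ : S => ℝ) 1 →ₗ[ℝ] ℝ where
  toFun x := ∑' s, (if s ∈ A then 1 else -1) * x s
  map_add' x y := by
    have h : ∀ z : lp (fun _ : S => ℝ) 1, Summable fun s => (if s ∈ A then 1 else -1) * z s :=
      fun z => .of_norm_bounded (ellOne_hasSum_norm z).summable fun s => by split_ifs <;> simp
    rw [← (h x).tsum_add (h y)]
    exact tsum_congr fun s => mul_add _ _ _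
  map_smul' c x := by
    rw [RingHom.id_apply, smul_eq_mul, ← tsum_mul_left]
    exact tsum_congr fun s => mul_left_comm _ _ _

lemma abs_signFunctional_le {S : Type*} (A : Set S) (x : lp (fun _ : S => ℝ) 1) :
    |signFunctional A x| ≤ ‖x‖ := by
  classical
  refine tsum_of_norm_bounded (f := fun s => (if s ∈ A then 1 else -1) * x s)
    (ellOne_hasSum_norm x) fun s => ?_
  split_ifs <;> simp

lemma signFunctional_eq_norm {S : Type*} {A : Set S} {x : lp (fun _ : S => ℝ) 1}
    (h : ∀ s, x s ≠ 0 → (s ∈ A ↔ 0 < x s)) : signFunctional A x = ‖x‖ := by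
  rw [← (ellOne_hasSum_norm x).tsum_eq]
  refine tsum_congr fun s => ?_
  rcases lt_trichotomy (x s) 0 with hs | hs | hs
  · rw [if_neg (fun hA => lt_asymm hs ((h s hs.ne).1 hA)), abs_of_neg hs, neg_one_mul]
  · simp [hs]
  · rw [if_pos ((h s hs.ne').2 hs), abs_of_pos hs, one_mul]

/-- With `S` embedded in `Set ℕ`, the sets of those `s` whose trace on `{0, …, k - 1}` belongs to a
given finite collection form a countable family, and they separate any two disjoint finite subsets
of `S`. The corresponding sign functionals therefore attain the norm at every finitely supported
vector. -/
theorem admitsApproximatingAnalyticNorm_ellOneFin {S : Type*} (φ : S → Set ℕ)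
    (hφ : Function.Injective φ) : AdmitsApproximatingAnalyticNorm (ellOneFin S) := by
  classical
  let tr : ℕ → S → Finset ℕ := fun k s => {n ∈ Finset.range k | n ∈ φ s}
  refine admitsApproximatingAnalyticNorm_of_norm_attaining (Λ := ℕ × Finset (Finset ℕ))
    (fun i => signFunctional {s | tr i.1 s ∈ i.2} ∘ₗ (ellOneFin S).subtype)
    (fun i x => abs_signFunctional_le _ _) ?_
  rintro ⟨x, hx⟩
  have hx : {s : S | x s ≠ 0}.Finite := hx
  obtain ⟨k, hk⟩ := exists_separating_initial_segment φ hφ hx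
  refine ⟨(k, (hx.toFinset.filter fun s => 0 < x s).image (tr k)), ?_⟩
  change |signFunctional _ x| = ‖x‖
  rw [signFunctional_eq_norm, abs_norm]
  intro s hs
  simp only [Set.mem_ofPred_eq, Finset.mem_image, Finset.mem_filter, Set.Finite.mem_toFinset]
  refine ⟨?_, fun h => ⟨s, ⟨hs, h⟩, rfl⟩⟩
  rintro ⟨t, ⟨ht, hpos⟩, hts⟩
  have : t = s := hk t ht s hs fun n hn => by
    simpa [tr, hn] using Finset.ext_iff.1 hts n
  exact this ▸ hpos

/-! ### Spaces with a countable Hamel basis -/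

/-- On a finite-dimensional subspace, compactness of the unit sphere yields finitely many
functionals in the dual unit ball that determine the norm up to a factor `1 + η`. -/
lemma exists_finset_dual_norming {X : Type*} [NormedAddCommGroup X] [NormedSpace ℝ X]
    (V : Submodule ℝ X) [FiniteDimensional ℝ V] {η : ℝ} (hη : 0 < η) :
    ∃ F : Finset (X →L[ℝ] ℝ), (∀ f ∈ F, ‖f‖ ≤ 1) ∧
      ∀ x ∈ V, x ≠ 0 → ∃ f ∈ F, ‖x‖ < (1 + η) * |f x| := by
  have hK : IsCompact (V ∩ Metric.sphere (0 : X) 1 : Set X) := by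
    have := (isCompact_sphere (0 : V) 1).image continuous_subtype_val
    refine this.of_isClosed_subset (V.closed_of_finiteDimensional.inter Metric.isClosed_sphere) ?_
    rintro x ⟨hxV, hx⟩
    exact ⟨⟨x, hxV⟩, by simpa using hx, rfl⟩
  obtain ⟨F, hF⟩ := hK.elim_finite_subcover
    (fun f : Metric.closedBall (0 : X →L[ℝ] ℝ) 1 => {x : X | 1 < (1 + η) * |(f : X →L[ℝ] ℝ) x|})
    (fun f => isOpen_lt continuous_const (by fun_prop)) (by
      rintro x ⟨-, hx⟩
      have hx : ‖x‖ = 1 := by simpa using hx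
      obtain ⟨f, hf, hfx⟩ := exists_dual_vector'' ℝ x
      refine Set.mem_iUnion.2 ⟨⟨f, by simpa using hf⟩, ?_⟩
      simp [hfx, hx, hη])
  classical
  refine ⟨F.image Subtype.val, fun f hf => ?_, fun x hxV hx => ?_⟩
  · obtain ⟨g, -, rfl⟩ := Finset.mem_image.1 hf
    exact mem_closedBall_zero_iff.1 g.2
  · have hpos := norm_pos_iff.2 hx
    have hmem : ‖x‖⁻¹ • x ∈ (V ∩ Metric.sphere (0 : X) 1 : Set X) :=
      ⟨V.smul_mem _ hxV, by simp [norm_smul, hpos.ne']⟩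
    obtain ⟨f, hfF, hf⟩ := Set.mem_iUnion₂.1 (hF hmem)
    refine ⟨f, Finset.mem_image_of_mem _ hfF, ?_⟩
    have hf : 1 < (1 + η) * |(f : X →L[ℝ] ℝ) (‖x‖⁻¹ • x)| := hf
    rw [map_smul, smul_eq_mul, abs_mul, abs_inv, abs_norm, mul_left_comm,
      lt_inv_mul_iff₀ hpos, mul_one] at hf
    exact hf

/-- The functionals chosen for the `m`-th subspace carry the weight `1 + δ / (m + 1)`. Only finitely
many belong to each `m`, so the weights tend to `1` along the whole family. -/
theorem admitsApproximatingAnalyticNorm_of_basis {X : Type*} [NormedAddCommGroup X]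
    [NormedSpace ℝ X] {ι : Type*} [Countable ι] (b : Module.Basis ι ℝ X) :
    AdmitsApproximatingAnalyticNorm X := by
  refine admitsApproximatingAnalyticNorm_of_countable fun δ hδ => ?_
  obtain ⟨e, he⟩ := exists_injective_nat ι
  let V : ℕ → Submodule ℝ X := fun m => Submodule.span ℝ (b '' (e ⁻¹' Set.Iic m))
  have hfd : ∀ m, FiniteDimensional ℝ (V m) := fun m =>
    FiniteDimensional.span_of_finite ℝ (((Set.finite_Iic m).preimage he.injOn).image b)
  have hη : ∀ m : ℕ, 0 < δ / (m + 1) := fun m => by positivity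
  choose F hF1 hF2 using fun m => exists_finset_dual_norming (V m) (hη m)
  refine ⟨Σ m, F m, inferInstance, fun i => δ / (i.1 + 1),
    fun i => (1 + δ / (i.1 + 1)) • ((i.2 : X →L[ℝ] ℝ) : X →ₗ[ℝ] ℝ), fun i => ?_, ?_,
    fun i x => ?_, fun x hx => ?_⟩
  · exact div_le_self hδ.le (by simp)
  · have h1 : Tendsto (fun i : Σ m, F m => i.1) cofinite cofinite :=
      Tendsto.cofinite_of_finite_preimage_singleton fun m =>
        (Set.finite_range (Sigma.mk m)).subset (by rintro ⟨_, f⟩ rfl; exact ⟨f, rfl⟩)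
    rw [Nat.cofinite_eq_atTop] at h1
    exact (tendsto_div_nat_add_one δ).comp h1
  · have := hη i.1
    rw [LinearMap.smul_apply, smul_eq_mul, abs_mul, abs_of_pos (by positivity)]
    refine mul_le_mul_of_nonneg_left ?_ (by positivity)
    simpa using (i.2 : X →L[ℝ] ℝ).le_of_opNorm_le (hF1 _ _ i.2.2) x
  · obtain ⟨m, hm⟩ : ∃ m, x ∈ V m := by
      obtain ⟨m, hm⟩ := ((b.repr x).support.image e).bddAbove
      refine ⟨m, (b.mem_span_image).2 fun i hi => hm ?_⟩
      exact Finset.mem_coe.2 (Finset.mem_image_of_mem e hi)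
    obtain ⟨f, hf, hfx⟩ := hF2 m x hm hx
    have := hη m
    refine ⟨⟨m, f, hf⟩, ?_⟩
    rw [LinearMap.smul_apply, smul_eq_mul, abs_mul, abs_of_pos (by positivity)]
    exact hfx

/-- The span of a countable dense set has a countable Hamel basis. -/
theorem exists_dense_admitsApproximatingAnalyticNorm (X : Type*) [NormedAddCommGroup X]
    [NormedSpace ℝ X] [TopologicalSpace.SeparableSpace X] :
    ∃ Y : Submodule ℝ X, Dense (Y : Set X) ∧ AdmitsApproximatingAnalyticNorm Y := by
  obtain ⟨s, hs, hsd⟩ := TopologicalSpace.exists_countable_dense X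
  obtain ⟨t, hts, hst, hli⟩ := exists_linearIndependent ℝ s
  have : Countable t := (hs.mono hts).to_subtype
  refine ⟨Submodule.span ℝ s, hsd.mono Submodule.subset_span, ?_⟩
  rw [← hst]
  have b := Module.Basis.span hli
  rw [Subtype.range_coe] at b
  exact admitsApproximatingAnalyticNorm_of_basis b

/-! ### The four assertions -/

theorem theoremA :
    -- (i)
    (Dense (ellInftyF : Set (lp (fun _ : ℕ => ℝ) ∞)) ∧
      AdmitsApproximatingAnalyticNorm ellInftyF) ∧
    -- (ii), normed spaces with a countable Hamel basis
    (∀ (X : Type u) [NormedAddCommGroup X] [NormedSpace ℝ X]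
      (ι : Type v) [Countable ι] (_ : Module.Basis ι ℝ X),
      AdmitsApproximatingAnalyticNorm X) ∧
    -- (ii), separable Banach spaces
    (∀ (X : Type w) [NormedAddCommGroup X] [NormedSpace ℝ X] [CompleteSpace X]
      [TopologicalSpace.SeparableSpace X],
      ∃ Y : Submodule ℝ X, Dense (Y : Set X) ∧ AdmitsApproximatingAnalyticNorm Y) ∧
    -- (iii)
    (∀ S : Type t, Cardinal.mk S = 𝔠 →
      Dense (ellOneFin S : Set (lp (fun _ : S => ℝ) 1)) ∧
        AdmitsApproximatingAnalyticNorm (ellOneFin S)) := by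
  refine ⟨⟨dense_ellInftyF, admitsApproximatingAnalyticNorm_ellInftyF⟩,
    fun X _ _ ι _ b => admitsApproximatingAnalyticNorm_of_basis b,
    fun X _ _ _ _ => exists_dense_admitsApproximatingAnalyticNorm X,
    fun S hS => ⟨dense_ellOneFin S, ?_⟩⟩
  have h : Cardinal.lift.{0} (Cardinal.mk S) = Cardinal.lift.{t} (Cardinal.mk (Set ℕ)) := by
    simp [hS]
  obtain ⟨φ⟩ := Cardinal.lift_mk_eq'.1 h
  exact admitsApproximatingAnalyticNorm_ellOneFin φ φ.injective
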